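/- We use the deterministic $\mathsf{CONGEST}$ model: the network is a finite simple graph on $n$ nodes, the nodes have distinct identifiers from $\{0,\dots,n^{c}-1\}$ for a constant $c$ and number their incident links arbitrarily, and initially each node knows only $n$, its own identifier and its degree. All nodes run the same deterministic program in synchronous rounds; in each round a node may send a (possibly different) message of $O(\log n)$ bits over each of its links, receives the messages of its neighbours and performs arbitrary local computation. At the end each node halts and outputs whether it belongs to the computed set. A graph has arboricity at most $\alpha$ if its edge set is the union of the edge sets of at most $\alpha$ spanning forests. A $\rho$-approximation of minimum dominating set is a dominating set whose size is at most $\rho$ times the size of a smallest dominating set. **Corollary.** For every constant $c$ there is a deterministic $\mathsf{CONGEST}$ algorithm such that, for every constant $\alpha$, on all $n$-node networks of arboricity at most $\alpha$ it halts within $O\!\left(\frac{\log n}{\log\log n}\right)$ rounds and computes an $O(\log n)$-approximation of minimum dominating set. Here $n\to\infty$, and the constants hidden in the two bounds may depend on $c$ and $\alpha$ only. -/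

import Mathlib

open Filter Asymptotics

universe u

/-- The arboricity of `G` is at most `α`: there are `α` spanning forests of `G` (some may be edgeless)
whose union has all the edges of `G`. -/
def ArboricityAtMost {V : Type u} (G : SimpleGraph V) (α : ℕ) : Prop :=
  ∃ F : Fin α → SimpleGraph V, (∀ i, (F i).IsAcyclic) ∧ (⨆ i, F i) = G

/-- `D` is a dominating set: the closed neighbourhood of `D` is the entire vertex set. -/
def IsDominating {V : Type u} (G : SimpleGraph V) (D : Finset V) : Prop :=
  ∀ v, v ∈ D ∨ ∃ u ∈ D, G.Adj u v

/-- `S` is a `ρ`-approximation of minimum dominating set: it is a dominating set, of size at most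
`ρ` times the size of every dominating set (that is, of a smallest one). -/
def IsApproxMDS {V : Type u} (G : SimpleGraph V) (ρ : ℝ) (S : Finset V) : Prop :=
  IsDominating G S ∧ ∀ D : Finset V, IsDominating G D → (S.card : ℝ) ≤ ρ * (D.card : ℝ)

/-- A communication network: a finite simple graph whose `n` nodes carry distinct identifiers
below `n ^ c` and number the links to their neighbours, in an arbitrary way, by `0, …, deg - 1`.
`port v w` is the number that `v` gives to its link to `w`; it has no meaning for `w` not adjacent
to `v`. -/
structure Network (V : Type u) [Fintype V] (c : ℕ) where
  graph : SimpleGraph V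
  ident : V → ℕ
  ident_injective : Function.Injective ident
  ident_lt : ∀ v, ident v < Fintype.card V ^ c
  port : V → V → ℕ
  port_bijOn : ∀ v,
    Set.BijOn (port v) (graph.neighborSet v) (Set.Iio (graph.neighborSet v).ncard)

/-- A deterministic CONGEST algorithm with Boolean outputs. All nodes run the same program and know
the number `n` of nodes. A node starts from its identifier and its degree; in every round it
sends one bit string through each of its ports (the empty string stands for silence) and
updates its state from the strings that arrive at its ports. A node halts, with output `b`, when
its state has output `some b`. The length of every message is at most
`bandwidth n = O(log n)`; local computation is free, as usual in this model. -/
structure CongestAlgorithm where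
  State : Type
  /-- The initial state, from `n`, the identifier and the degree of the node. -/
  init : (n ident degree : ℕ) → State
  /-- The message sent through a given port. -/
  send : (n : ℕ) → State → (port : ℕ) → List Bool
  /-- The new state, from the old one and the messages received, by port. -/
  update : (n : ℕ) → State → (ℕ → List Bool) → State
  output : (n : ℕ) → State → Option Bool
  bandwidth : ℕ → ℕ
  length_send_le : ∀ n s i, (send n s i).length ≤ bandwidth n
  bandwidth_isBigO : (fun n => (bandwidth n : ℝ)) =O[atTop] fun n : ℕ => Real.log (n : ℝ)

namespace CongestAlgorithm

variable {V : Type u} [Fintype V] {c : ℕ}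

/-- The message that a node in state `s` sends through port `i`; halted nodes are silent. -/
def emit (A : CongestAlgorithm) (n : ℕ) (s : A.State) (i : ℕ) : List Bool :=
  if (A.output n s).isSome then [] else A.send n s i

open Classical in
/-- What arrives at port `i` of `v` when the nodes are in the states `s`: the message that the
neighbour `w` at that port sends through its own port for `v`. Numbers that are not ports of `v`
receive the empty string. -/
noncomputable def inbox (A : CongestAlgorithm) (N : Network V c) (s : V → A.State) (v : V)
    (i : ℕ) : List Bool :=
  if h : ∃ w, N.graph.Adj v w ∧ N.port v w = i then
    A.emit (Fintype.card V) (s h.choose) (N.port h.choose v)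
  else []

/-- One synchronous round: all nodes that have not halted update their states. -/
noncomputable def round (A : CongestAlgorithm) (N : Network V c) (s : V → A.State) :
    V → A.State := fun v =>
  if (A.output (Fintype.card V) (s v)).isSome then s v
  else A.update (Fintype.card V) (s v) (A.inbox N s v)

/-- The states of all nodes after `t` rounds. -/
noncomputable def run (A : CongestAlgorithm) (N : Network V c) : ℕ → V → A.State
  | 0 => fun v => A.init (Fintype.card V) (N.ident v) (N.graph.neighborSet v).ncard
  | t + 1 => A.round N (run A N t)

/-- Every node has halted after at most `t` rounds. -/
def HaltsWithin (A : CongestAlgorithm) (N : Network V c) (t : ℕ) : Prop :=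
  ∀ v, (A.output (Fintype.card V) (A.run N t v)).isSome

/-- The set of nodes that have halted with output `true` after at most `t` rounds. -/
noncomputable def outputSet (A : CongestAlgorithm) (N : Network V c) (t : ℕ) : Finset V :=
  Finset.univ.filter fun v => A.output (Fintype.card V) (A.run N t v) = some true

end CongestAlgorithm

/-! Primal-dual argument. Scaled by `n`, a packing gives every vertex a value so that each closed
neighbourhood has load at most `n`; the total value is then at most `n` times the size of any
dominating set. With `L = growth n`, about `(log n)^(1/4)`, values start at 1 and those of
undominated vertices are multiplied by `L` for `K = log_L n - 2` iterations; the output consists of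
the heavy vertices (load at least `n / L`) and the undominated ones.

An undominated vertex has grown in every iteration, so its value is `L ^ K`, at least `n / L ^ 3`,
and there are few of them (`card_undominated_le`). All values are at most `L ^ K`, so bounded
arboricity lets few vertices be heavy (`card_heavy_le`). Together this is a factor `L ^ 4 = O(log
n)`, in `O(log n / log L)` rounds. Since `L` tends to infinity, it eventually exceeds any function
of `α`, so the algorithm need not know `α`. -/

/-- An acyclic graph has an orientation with at most one outgoing edge at each vertex. -/
lemma SimpleGraph.IsAcyclic.exists_parent {V : Type u} {F : SimpleGraph V} (hF : F.IsAcyclic) :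
    ∃ p : V → V, ∀ u v, F.Adj u v → p u = v ∨ p v = u := by
  classical
  have hroot : ∀ u, F.Reachable u (F.connectedComponentMk u).out := fun u =>
    (SimpleGraph.ConnectedComponent.exact (F.connectedComponentMk u).out_eq).symm
  choose P hP using fun u => (hroot u).exists_isPath
  -- Each component is rooted at its representative, and the parent is the next vertex on the path
  -- to the root.
  refine ⟨fun u => (P u).snd, fun u v huv => ?_⟩
  by_cases hv : v ∈ (P u).support
  · exact .inl (hF.eq_snd_of_adj_start (hP u) huv hv).symm
  · right
    have hc : F.connectedComponentMk u = F.connectedComponentMk v :=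
      SimpleGraph.ConnectedComponent.sound huv.reachable
    -- The endpoint is generalized because the roots of `u` and `v` are only propositionally equal.
    -- Prepending `v` to `P u` gives the unique path from `v` to the root.
    have key : ∀ (r : V) (Q : F.Walk v r), Q.IsPath →
        r = (F.connectedComponentMk u).out → Q.snd = u := by
      rintro r Q hQ rfl
      have hpath : (SimpleGraph.Walk.cons huv.symm (P u)).IsPath := (hP u).cons hv
      have := congrArg Subtype.val ((hF.subsingleton_path _ _).elim ⟨Q, hQ⟩ ⟨_, hpath⟩)
      simp only at this
      rw [this]
      simp
    exact key _ (P v) (hP v) (by rw [hc])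

open Classical in
/-- The sum of `x` over the open neighbourhood of `v`. -/
noncomputable def neighborSum {V : Type u} [Fintype V] (G : SimpleGraph V) (x : V → ℕ) (v : V) : ℕ :=
  ∑ u with G.Adj v u, x u

/-- The sum of `x` over the closed neighbourhood of `v`. -/
noncomputable def load {V : Type u} [Fintype V] (G : SimpleGraph V) (x : V → ℕ) (v : V) : ℕ :=
  x v + neighborSum G x v

/-! ### Packings, duality and the approximation ratio -/

section Packing

variable {V : Type u} [Fintype V] {G : SimpleGraph V} {x : V → ℕ}

/-- The neighbours of a vertex are its parent, contributing at most `M`, and its children; every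
vertex is the child of only one vertex, so the children contribute at most the total of `x`. -/
lemma sum_neighborSum_le_of_isAcyclic (hG : G.IsAcyclic) {M : ℕ} (hx : ∀ v, x v ≤ M)
    (S : Finset V) : ∑ v ∈ S, neighborSum G x v ≤ S.card * M + ∑ v, x v := by
  classical
  obtain ⟨p, hp⟩ := hG.exists_parent
  have h1 : ∀ v, neighborSum G x v ≤ M + ∑ u with p u = v, x u := by
    intro v
    calc neighborSum G x v ≤ ∑ u ∈ {p v} ∪ Finset.univ.filter (fun u => p u = v), x u := by
          refine Finset.sum_le_sum_of_subset fun u hu => ?_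
          simp only [Finset.mem_filter, Finset.mem_univ, true_and] at hu
          rcases hp v u hu with h | h <;> simp [h]
      _ ≤ ∑ u ∈ {p v}, x u + ∑ u with p u = v, x u := by
          rw [← Finset.sum_union_inter]; exact Nat.le_add_right _ _
      _ ≤ _ := by simpa using hx _
  calc ∑ v ∈ S, neighborSum G x v ≤ ∑ v ∈ S, (M + ∑ u with p u = v, x u) :=
        Finset.sum_le_sum fun v _ => h1 v
    _ = S.card * M + ∑ v ∈ S, ∑ u with p u = v, x u := by simp [Finset.sum_add_distrib]
    _ ≤ S.card * M + ∑ v, ∑ u with p u = v, x u := by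
        gcongr; exact Finset.subset_univ S
    _ = _ := by rw [Finset.sum_fiberwise Finset.univ p x]

lemma sum_neighborSum_le_of_arboricityAtMost {α : ℕ} (hG : ArboricityAtMost G α) {M : ℕ}
    (hx : ∀ v, x v ≤ M) (S : Finset V) :
    ∑ v ∈ S, neighborSum G x v ≤ α * (S.card * M + ∑ v, x v) := by
  classical
  obtain ⟨F, hF, rfl⟩ := hG
  have h1 : ∀ v, neighborSum (⨆ i, F i) x v ≤ ∑ i, neighborSum (F i) x v := by
    intro v
    simp only [neighborSum, Finset.sum_filter]
    rw [Finset.sum_comm]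
    refine Finset.sum_le_sum fun u _ => ?_
    split_ifs with h
    · obtain ⟨i, hi⟩ := SimpleGraph.iSup_adj.1 h
      refine le_trans ?_ (Finset.single_le_sum (fun _ _ => Nat.zero_le _) (Finset.mem_univ i))
      rw [if_pos hi]
    · exact Nat.zero_le _
  calc ∑ v ∈ S, neighborSum (⨆ i, F i) x v ≤ ∑ v ∈ S, ∑ i, neighborSum (F i) x v :=
        Finset.sum_le_sum fun v _ => h1 v
    _ = ∑ i, ∑ v ∈ S, neighborSum (F i) x v := Finset.sum_comm
    _ ≤ ∑ _i : Fin α, (S.card * M + ∑ v, x v) :=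
        Finset.sum_le_sum fun i _ => sum_neighborSum_le_of_isAcyclic (hF i) hx S
    _ = _ := by simp

/-- Weak duality between packings and dominating sets. -/
lemma sum_le_mul_card_of_isDominating {n : ℕ} (hx : ∀ v, load G x v ≤ n) {D : Finset V}
    (hD : IsDominating G D) : ∑ v, x v ≤ n * D.card := by
  classical
  calc ∑ v, x v ≤ ∑ v, ∑ w ∈ D, if w = v ∨ G.Adj w v then x v else 0 := by
        refine Finset.sum_le_sum fun v _ => ?_
        obtain ⟨w, hw, h⟩ : ∃ w ∈ D, w = v ∨ G.Adj w v := by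
          rcases hD v with h | ⟨w, hw, h⟩
          · exact ⟨v, h, .inl rfl⟩
          · exact ⟨w, hw, .inr h⟩
        refine le_trans ?_ (Finset.single_le_sum (fun _ _ => Nat.zero_le _) hw)
        rw [if_pos h]
    _ = ∑ w ∈ D, ∑ v, if w = v ∨ G.Adj w v then x v else 0 := Finset.sum_comm
    _ ≤ ∑ w ∈ D, load G x w := by
        refine Finset.sum_le_sum fun w _ => ?_
        rw [load, neighborSum, Finset.sum_filter]
        calc _ ≤ ∑ v, ((if w = v then x v else 0) + if G.Adj w v then x v else 0) := by
              refine Finset.sum_le_sum fun v _ => ?_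
              split_ifs <;> simp_all
          _ = _ := by simp [Finset.sum_add_distrib]
    _ ≤ _ := by
        rw [mul_comm]; simpa using Finset.sum_le_card_nsmul D _ n fun w _ => hx w

/-- No vertex of the closed neighbourhood of `u` has load at least `n / L`. -/
def Undominated (G : SimpleGraph V) (L n : ℕ) (x : V → ℕ) (u : V) : Prop :=
  L * load G x u < n ∧ ∀ v, G.Adj u v → L * load G x v < n

open Classical in
/-- The packing after `i` iterations: all values start at `1`, and in every iteration those of the
undominated vertices are multiplied by `L`. -/
noncomputable def packing (G : SimpleGraph V) (L n : ℕ) : ℕ → V → ℕ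
  | 0, _ => 1
  | i + 1, u => if Undominated G L n (packing G L n i) u then L * packing G L n i u
      else packing G L n i u

variable {L n : ℕ}

lemma packing_le_pow (hL : 1 ≤ L) (i : ℕ) (u : V) : packing G L n i u ≤ L ^ i := by
  induction i with
  | zero => simp [packing]
  | succ i ih =>
    rw [packing, pow_succ']
    split_ifs
    · gcongr
    · nlinarith

lemma packing_le_succ (hL : 1 ≤ L) (i : ℕ) (u : V) : packing G L n i u ≤ packing G L n (i + 1) u := by
  rw [packing]
  split_ifs
  · exact Nat.le_mul_of_pos_left _ hL
  · rfl

lemma load_mono {x y : V → ℕ} (h : ∀ u, x u ≤ y u) (v : V) : load G x v ≤ load G y v :=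
  add_le_add (h v) (Finset.sum_le_sum fun u _ => h u)

/-- Loads never decrease, so a vertex undominated now was undominated in all earlier iterations. -/
lemma packing_eq_pow_of_undominated (hL : 1 ≤ L) {i : ℕ} {u : V}
    (hu : Undominated G L n (packing G L n i) u) : packing G L n i u = L ^ i := by
  induction i with
  | zero => simp [packing]
  | succ i ih =>
    have hle : ∀ v, L * load G (packing G L n i) v ≤ L * load G (packing G L n (i + 1)) v :=
      fun v => Nat.mul_le_mul_left _ (load_mono (packing_le_succ hL i) v)
    have h : Undominated G L n (packing G L n i) u :=
      ⟨(hle u).trans_lt hu.1, fun v hv => (hle v).trans_lt (hu.2 v hv)⟩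
    rw [packing, if_pos h, ih h, pow_succ']

/-- One iteration multiplies a load by at most `L`, which is harmless at a light vertex; a heavy
vertex freezes all values in its closed neighbourhood. -/
lemma load_packing_le (hL : 1 ≤ L) (i : ℕ) (v : V) :
    load G (packing G L (Fintype.card V) i) v ≤ Fintype.card V := by
  classical
  induction i with
  | zero =>
    have h : v ∉ Finset.univ.filter (G.Adj v) := by simp
    have := Finset.card_le_univ (insert v (Finset.univ.filter (G.Adj v)))
    rw [Finset.card_insert_of_notMem h] at this
    simpa [load, neighborSum, packing, add_comm] using this
  | succ i ih =>
    by_cases hv : L * load G (packing G L (Fintype.card V) i) v < Fintype.card V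
    · refine le_trans ?_ hv.le
      have h : ∀ u, packing G L (Fintype.card V) (i + 1) u ≤ L * packing G L (Fintype.card V) i u := by
        intro u
        rw [packing]
        split_ifs
        · rfl
        · exact Nat.le_mul_of_pos_left _ hL
      rw [load, load, neighborSum, neighborSum, mul_add, Finset.mul_sum]
      exact add_le_add (h v) (Finset.sum_le_sum fun u _ => h u)
    · refine le_trans (le_of_eq ?_) ih
      rw [load, load, neighborSum, neighborSum]
      congr 1
      · rw [packing, if_neg fun h => hv h.1]
      · refine Finset.sum_congr rfl fun u hu => ?_
        rw [packing, if_neg fun h => hv (h.2 v (by simpa using (Finset.mem_filter.1 hu).2.symm))]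

/-- The vertices selected by a packing: those of load at least `n / L`, and the undominated ones. -/
def Selected (G : SimpleGraph V) (L n : ℕ) (x : V → ℕ) (v : V) : Prop :=
  n ≤ L * load G x v ∨ Undominated G L n x v

open Classical in
lemma isDominating_selected (x : V → ℕ) :
    IsDominating G (Finset.univ.filter (Selected G L n x)) := by
  intro v
  by_cases hv : Selected G L n x v
  · simp [hv]
  · right
    simp only [Selected, Undominated, not_or, not_le, not_and, not_forall, not_lt] at hv
    obtain ⟨w, hw, h⟩ := hv.2 hv.1
    exact ⟨w, by simp [Selected, h], hw.symm⟩

lemma card_heavy_le {α : ℕ} (hG : ArboricityAtMost G α) {M : ℕ} (hx : ∀ v, x v ≤ M)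
    (hn : 0 < n) (hload : ∀ v, load G x v ≤ n) (hM : 2 * (α * L * M) ≤ n)
    {S : Finset V} (hS : ∀ v ∈ S, n ≤ L * load G x v) {D : Finset V} (hD : IsDominating G D) :
    S.card ≤ 2 * (α + 1) * L * D.card := by
  have h1 : S.card * n ≤ L * ∑ v ∈ S, load G x v := by
    rw [Finset.mul_sum]; simpa using Finset.card_nsmul_le_sum S _ n hS
  have h2 : ∑ v ∈ S, load G x v ≤ ∑ v, x v + α * (S.card * M + ∑ v, x v) := by
    simp only [load, Finset.sum_add_distrib]
    exact add_le_add (Finset.sum_le_sum_of_subset (Finset.subset_univ S))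
      (sum_neighborSum_le_of_arboricityAtMost hG hx S)
  have h3 := sum_le_mul_card_of_isDominating hload hD
  set X := ∑ v, x v
  have h4 : S.card * n ≤ L * (X + α * (S.card * M + X)) := h1.trans (Nat.mul_le_mul_left _ h2)
  have h5 : S.card * (2 * (α * L * M)) ≤ S.card * n := Nat.mul_le_mul_left _ hM
  have h6 : (2 * (α + 1) * L) * X ≤ (2 * (α + 1) * L) * (n * D.card) := Nat.mul_le_mul_left _ h3
  refine Nat.le_of_mul_le_mul_left ?_ hn
  -- By `h5`, the term `α * L * M * S.card` is at most half of `S.card * n` and is absorbed on the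
  -- left.
  nlinarith

lemma card_undominated_le (hL : 1 ≤ L) {i : ℕ} (hi : Fintype.card V ≤ L ^ 3 * L ^ i)
    {W : Finset V}
    (hW : ∀ v ∈ W, Undominated G L (Fintype.card V) (packing G L (Fintype.card V) i) v)
    {D : Finset V} (hD : IsDominating G D) : W.card ≤ L ^ 3 * D.card := by
  have h1 : W.card * L ^ i ≤ ∑ v, packing G L (Fintype.card V) i v := by
    refine le_trans ?_ (Finset.sum_le_sum_of_subset (Finset.subset_univ W))
    simpa using Finset.card_nsmul_le_sum W _ (L ^ i)
      fun v hv => (packing_eq_pow_of_undominated hL (hW v hv)).ge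
  have h2 := sum_le_mul_card_of_isDominating (load_packing_le hL i) hD
  refine Nat.le_of_mul_le_mul_left ?_ (pow_pos hL i)
  calc L ^ i * W.card ≤ Fintype.card V * D.card := by rw [mul_comm]; exact h1.trans h2
    _ ≤ L ^ 3 * L ^ i * D.card := Nat.mul_le_mul_right _ hi
    _ = _ := by ring

open Classical in
lemma card_selected_le {α : ℕ} (hG : ArboricityAtMost G α) (hα : 2 * (α + 1) ≤ L)
    (hn : L ^ 2 ≤ Fintype.card V) {D : Finset V} (hD : IsDominating G D) :
    (Finset.univ.filter (Selected G L (Fintype.card V)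
      (packing G L (Fintype.card V) (Nat.log L (Fintype.card V) - 2)))).card ≤ L ^ 4 * D.card := by
  have hL : 1 < L := by omega
  have hL1 : 1 ≤ L := hL.le
  have hn0 : 0 < Fintype.card V := lt_of_lt_of_le (by positivity) hn
  obtain ⟨K, hK⟩ := Nat.exists_eq_add_of_le (Nat.le_log_of_pow_le hL hn)
  have hlo : L ^ (2 + K) ≤ Fintype.card V := hK ▸ Nat.pow_log_le_self L hn0.ne'
  have hhi : Fintype.card V < L ^ (2 + K + 1) := hK ▸ Nat.lt_pow_succ_log_self hL _
  rw [hK, Nat.add_sub_cancel_left]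
  have hsplit : Finset.univ.filter (Selected G L (Fintype.card V) (packing G L (Fintype.card V) K)) =
      Finset.univ.filter (fun v =>
        Fintype.card V ≤ L * load G (packing G L (Fintype.card V) K) v) ∪
      Finset.univ.filter
        (Undominated G L (Fintype.card V) (packing G L (Fintype.card V) K)) := by
    ext v; simp [Selected]
  rw [hsplit]
  refine (Finset.card_union_le _ _).trans ?_
  have h1 := card_heavy_le (L := L) (S := Finset.univ.filter fun v =>
      Fintype.card V ≤ L * load G (packing G L (Fintype.card V) K) v)
    hG (packing_le_pow hL1 K) hn0 (load_packing_le hL1 K)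
    -- The two iterations left out pay for this: `2 * α ≤ L` gives `2 * α * L * L ^ K ≤ L ^ (K + 2)
    -- ≤ n`.
    (by
      refine le_trans ?_ hlo
      calc 2 * (α * L * L ^ K) = (2 * α) * L * L ^ K := by ring
        _ ≤ L * L * L ^ K := by gcongr; omega
        _ = _ := by ring) (by simp) hD
  have h2 := card_undominated_le (G := G) (L := L) (i := K) (W := Finset.univ.filter
      (Undominated G L (Fintype.card V) (packing G L (Fintype.card V) K)))
    hL1 (hhi.le.trans (le_of_eq (by ring))) (by simp) hD
  refine (add_le_add h1 h2).trans ?_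
  rw [← add_mul]
  refine Nat.mul_le_mul_right _ ?_
  calc 2 * (α + 1) * L + L ^ 3 ≤ L * L + L ^ 3 := by gcongr
    _ ≤ 1 * (L * L * L) + L ^ 3 := by nlinarith [Nat.mul_le_mul_left (L * L) hL1]
    _ = 2 * L ^ 3 := by ring
    _ ≤ L * L ^ 3 := by gcongr; exact hL
    _ = _ := by ring

end Packing

/-! ### The algorithm and its simulation -/

/-- The factor by which packing values grow, about the fourth root of `log n`. -/
def growth (n : ℕ) : ℕ := 2 + Nat.sqrt (Nat.sqrt (Nat.log 2 n))

/-- The number of iterations of the packing procedure. -/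
def iterations (n : ℕ) : ℕ := Nat.log (growth n) n - 2

/-- The state of a node: the round number, its degree, the current load of its closed neighbourhood
and whether it was undominated when it last checked. -/
structure PackingState where
  time : ℕ
  degree : ℕ
  load : ℕ
  undominated : Bool

/-- Each iteration takes two rounds: in the first one, nodes announce whether they have load at
least `n / growth n`; in the second one, whether they are undominated. -/
def packingAlgorithm : CongestAlgorithm where
  State := PackingState
  init _ _ d := ⟨0, d, d + 1, false⟩
  send n s _ := if Even s.time then [decide (n ≤ growth n * s.load)] else [s.undominated]
  update n s m :=
    if Even s.time then
      { s with
        time := s.time + 1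
        undominated := decide (growth n * s.load < n ∧ ∀ i < s.degree, m i ≠ [true]) }
    else
      { s with
        time := s.time + 1
        load := s.load + (growth n - 1) * growth n ^ (s.time / 2) *
          ((if s.undominated then 1 else 0) +
            ((Finset.range s.degree).filter fun i => m i = [true]).card) }
  output n s :=
    if s.time < 2 * iterations n + 1 then none
    else some (decide (n ≤ growth n * s.load) || s.undominated)
  bandwidth _ := 1
  length_send_le n s i := by split_ifs <;> simp
  bandwidth_isBigO := by
    simp only [Nat.cast_one]
    exact ((Real.isLittleO_const_log_atTop (c := (1 : ℝ))).comp_tendsto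
      tendsto_natCast_atTop_atTop).isBigO

lemma CongestAlgorithm.inbox_port {V : Type u} [Fintype V] {c : ℕ} (A : CongestAlgorithm)
    (N : Network V c) (s : V → A.State) {v w : V} (h : N.graph.Adj v w) :
    A.inbox N s v (N.port v w) = A.emit (Fintype.card V) (s w) (N.port w v) := by
  have hex : ∃ w', N.graph.Adj v w' ∧ N.port v w' = N.port v w := ⟨w, h, rfl⟩
  have hw : hex.choose = w :=
    (N.port_bijOn v).injOn hex.choose_spec.1 h hex.choose_spec.2
  rw [inbox, dif_pos hex, hw]

section Simulation

variable {V : Type u} [Fintype V] {c : ℕ} (N : Network V c)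

lemma Network.exists_port {v : V} {i : ℕ} (hi : i < (N.graph.neighborSet v).ncard) :
    ∃ w, N.graph.Adj v w ∧ N.port v w = i :=
  (N.port_bijOn v).surjOn hi

lemma Network.forall_port {v : V} {p : ℕ → Prop} :
    (∀ i < (N.graph.neighborSet v).ncard, p i) ↔ ∀ w, N.graph.Adj v w → p (N.port v w) := by
  constructor
  · exact fun h w hw => h _ ((N.port_bijOn v).mapsTo hw)
  · intro h i hi
    obtain ⟨w, hw, rfl⟩ := N.exists_port hi
    exact h w hw

open Classical in
lemma Network.card_filter_port {v : V} {p : ℕ → Prop} [DecidablePred p] :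
    ((Finset.range (N.graph.neighborSet v).ncard).filter p).card =
      (Finset.univ.filter fun w => N.graph.Adj v w ∧ p (N.port v w)).card := by
  symm
  refine Finset.card_bij (fun w _ => N.port v w) ?_ ?_ ?_
  · intro w hw
    simp only [Finset.mem_filter, Finset.mem_univ, true_and, Finset.mem_range] at hw ⊢
    exact ⟨(N.port_bijOn v).mapsTo hw.1, hw.2⟩
  · intro w hw w' hw' h
    simp only [Finset.mem_filter, Finset.mem_univ, true_and] at hw hw'
    exact (N.port_bijOn v).injOn hw.1 hw'.1 h
  · intro i hi
    simp only [Finset.mem_filter, Finset.mem_range] at hi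
    obtain ⟨w, hw, rfl⟩ := N.exists_port hi.1
    exact ⟨w, by simp [hw, hi.2], rfl⟩

open Classical in
-- Why one-bit messages suffice: all values that grow equal `L ^ i`, so a node updates its load by
-- merely counting undominated neighbours.
lemma load_packing_succ {G : SimpleGraph V} {L n : ℕ} (hL : 1 ≤ L) (i : ℕ) (v : V) :
    load G (packing G L n (i + 1)) v = load G (packing G L n i) v + (L - 1) * L ^ i *
      ((if Undominated G L n (packing G L n i) v then 1 else 0) +
        (Finset.univ.filter fun w =>
          G.Adj v w ∧ Undominated G L n (packing G L n i) w).card) := by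
  have h : ∀ u, packing G L n (i + 1) u = packing G L n i u +
      (L - 1) * L ^ i * (if Undominated G L n (packing G L n i) u then 1 else 0) := by
    intro u
    rw [packing]
    split_ifs with hu
    · obtain ⟨l, rfl⟩ := Nat.exists_eq_add_of_le' hL
      rw [packing_eq_pow_of_undominated hL hu, Nat.add_sub_cancel]
      ring
    · simp
  rw [load, load, neighborSum, neighborSum, h v, Finset.sum_congr rfl fun u _ => h u,
    Finset.sum_add_distrib, ← Finset.mul_sum, Finset.sum_boole, Finset.filter_filter]
  push_cast
  ring

lemma one_le_growth (n : ℕ) : 1 ≤ growth n := by unfold growth; omega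

open Classical in
/-- The state in which `packingAlgorithm` has a node after `t` rounds. -/
noncomputable def packingStateAt (t : ℕ) (v : V) : packingAlgorithm.State := PackingState.mk
  (time := t)
  (degree := (N.graph.neighborSet v).ncard)
  (load := load N.graph (packing N.graph (growth (Fintype.card V)) (Fintype.card V) (t / 2)) v)
  (undominated := decide (0 < t ∧ Undominated N.graph (growth (Fintype.card V)) (Fintype.card V)
    (packing N.graph (growth (Fintype.card V)) (Fintype.card V) ((t - 1) / 2)) v))

lemma run_packingAlgorithm {t : ℕ} (ht : t ≤ 2 * iterations (Fintype.card V) + 1) :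
    packingAlgorithm.run N t = packingStateAt N t := by
  classical
  induction t with
  | zero =>
    funext v
    simp only [CongestAlgorithm.run, packingAlgorithm, packingStateAt, load, neighborSum, packing,
      lt_irrefl, false_and, decide_false, PackingState.mk.injEq, true_and, and_true,
      Finset.sum_const, smul_eq_mul, mul_one, Nat.zero_div]
    rw [add_comm, Set.ncard_eq_toFinset_card']
    congr 2
    ext w; simp
  | succ t ih =>
    have hout : ∀ v, packingAlgorithm.output (Fintype.card V) (packingStateAt N t v) = none := by
      intro v
      simp only [packingAlgorithm, packingStateAt]
      rw [if_pos (by omega)]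
    have hin : ∀ v w, N.graph.Adj v w →
        packingAlgorithm.inbox N (packingStateAt N t) v (N.port v w) =
          packingAlgorithm.send (Fintype.card V) (packingStateAt N t w) (N.port w v) := by
      intro v w h
      rw [CongestAlgorithm.inbox_port _ _ _ h, CongestAlgorithm.emit, hout]
      rfl
    funext v
    rw [CongestAlgorithm.run, ih (by omega), CongestAlgorithm.round, hout]
    simp only [Option.isSome_none, Bool.false_eq_true, if_false]
    replace hin := hin v
    generalize packingAlgorithm.inbox N (packingStateAt N t) v = m at hin ⊢
    -- Even rounds refresh the flag `undominated`, odd rounds the load. Stopping after an odd number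
    -- of rounds makes both refer to the same packing.
    rcases Nat.even_or_odd' t with ⟨i, rfl | rfl⟩
    · have hev : Even (2 * i) := even_two_mul i
      have h1 : (2 * i + 1) / 2 = i := by omega
      have h2 : 2 * i / 2 = i := by omega
      simp only [packingAlgorithm, packingStateAt, if_pos hev, h1, h2, Nat.add_sub_cancel,
        PackingState.mk.injEq, true_and, Nat.succ_pos, decide_eq_decide, Undominated]
      refine and_congr_right fun _ => ?_
      rw [N.forall_port]
      refine forall₂_congr fun w hw => ?_
      have := hin w hw
      simp only [packingAlgorithm, packingStateAt, if_pos hev, h2] at this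
      rw [this]
      simp
    · have hodd : ¬ Even (2 * i + 1) := by simp
      have h1 : (2 * i + 1) / 2 = i := by omega
      have h2 : (2 * i + 1 + 1) / 2 = i + 1 := by omega
      simp only [packingAlgorithm, packingStateAt, if_neg hodd, h1, h2, Nat.add_sub_cancel,
        PackingState.mk.injEq, true_and, Nat.succ_pos, and_true, decide_eq_true_eq,
        show 2 * i / 2 = i by omega]
      rw [load_packing_succ (one_le_growth _), N.card_filter_port]
      congr 4
      ext w
      simp only [Finset.mem_filter, Finset.mem_univ, true_and]
      refine and_congr_right fun hw => ?_
      have := hin w hw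
      simp only [packingAlgorithm, packingStateAt, if_neg hodd, h1, Nat.add_sub_cancel,
        Nat.succ_pos, true_and, show 2 * i / 2 = i by omega] at this
      rw [this]
      simp

lemma haltsWithin_packingAlgorithm :
    packingAlgorithm.HaltsWithin N (2 * iterations (Fintype.card V) + 1) := by
  intro v
  rw [run_packingAlgorithm N le_rfl]
  simp [packingAlgorithm, packingStateAt]

open Classical in
lemma outputSet_packingAlgorithm :
    packingAlgorithm.outputSet N (2 * iterations (Fintype.card V) + 1) =
      Finset.univ.filter (Selected N.graph (growth (Fintype.card V)) (Fintype.card V)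
        (packing N.graph (growth (Fintype.card V)) (Fintype.card V)
          (iterations (Fintype.card V)))) := by
  ext v
  rw [CongestAlgorithm.outputSet, run_packingAlgorithm N le_rfl]
  have h1 : (2 * iterations (Fintype.card V) + 1) / 2 = iterations (Fintype.card V) := by omega
  have h2 : 2 * iterations (Fintype.card V) / 2 = iterations (Fintype.card V) := by omega
  simp [packingAlgorithm, packingStateAt, Selected, h1, h2]

end Simulation

/-! ### Asymptotics of the growth factor and the round count -/

lemma log_le_growth_pow (n : ℕ) : Real.log n ≤ (growth n : ℝ) ^ 4 := by
  rcases Nat.eq_zero_or_pos n with rfl | hn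
  · simp
  have h1 : Nat.log 2 n + 1 ≤ growth n ^ 4 := by
    have ha := Nat.lt_succ_sqrt' (Nat.log 2 n)
    have hb := Nat.lt_succ_sqrt' (Nat.sqrt (Nat.log 2 n))
    rw [Nat.succ_eq_add_one] at ha hb
    calc Nat.log 2 n + 1 ≤ (Nat.sqrt (Nat.log 2 n) + 1) ^ 2 := ha
      _ ≤ (growth n ^ 2) ^ 2 := by
          gcongr
          refine Nat.succ_le_of_lt (hb.trans_le ?_)
          gcongr
          unfold growth; omega
      _ = _ := by ring
  have h2 : (n : ℝ) ≤ 2 ^ (Nat.log 2 n + 1) := by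
    exact_mod_cast (Nat.lt_pow_succ_log_self one_lt_two n).le
  calc Real.log n ≤ Real.log (2 ^ (Nat.log 2 n + 1)) := Real.log_le_log (by positivity) h2
    _ = ((Nat.log 2 n + 1 : ℕ) : ℝ) * Real.log 2 := by rw [Real.log_pow]
    _ ≤ ((Nat.log 2 n + 1 : ℕ) : ℝ) * 1 := by
        gcongr; linarith [Real.log_two_lt_d9]
    _ ≤ _ := by rw [mul_one]; exact_mod_cast h1

/-- Here `81 = 3 ^ 4` comes from `2 + s ≤ 3 * s` for `s ≥ 1`, and the further factor 2 from
`Real.log 2 ≥ 1 / 2`. -/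
lemma growth_pow_le {n : ℕ} (hn : 2 ≤ n) : (growth n : ℝ) ^ 4 ≤ 162 * Real.log n := by
  have hl : 1 ≤ Nat.log 2 n := Nat.le_log_of_pow_le one_lt_two (by simpa using hn)
  have h1 : growth n ^ 4 ≤ 81 * Nat.log 2 n := by
    have hs : 1 ≤ Nat.sqrt (Nat.sqrt (Nat.log 2 n)) := by
      rw [Nat.le_sqrt', Nat.le_sqrt']; simpa using hl
    calc growth n ^ 4 ≤ (3 * Nat.sqrt (Nat.sqrt (Nat.log 2 n))) ^ 4 := by
          gcongr; unfold growth; omega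
      _ = 81 * (Nat.sqrt (Nat.sqrt (Nat.log 2 n)) ^ 2) ^ 2 := by ring
      _ ≤ 81 * Nat.sqrt (Nat.log 2 n) ^ 2 := by gcongr; exact Nat.sqrt_le' _
      _ ≤ _ := by gcongr; exact Nat.sqrt_le' _
  have h2 : (Nat.log 2 n : ℝ) * Real.log 2 ≤ Real.log n := by
    rw [← Real.log_pow]
    refine Real.log_le_log (by positivity) ?_
    exact_mod_cast Nat.pow_log_le_self 2 (by omega)
  have h3 : (growth n : ℝ) ^ 4 ≤ 81 * Nat.log 2 n := by exact_mod_cast h1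
  have h4 : (0 : ℝ) ≤ Nat.log 2 n := Nat.cast_nonneg _
  nlinarith [Real.log_two_gt_d9]

lemma tendsto_growth : Tendsto growth atTop atTop := by
  have hl := Real.tendsto_log_atTop.comp (tendsto_natCast_atTop_atTop (R := ℝ))
  refine tendsto_atTop.2 fun b => ?_
  filter_upwards [hl.eventually_ge_atTop ((b : ℝ) ^ 4)] with n hn
  have := hn.trans (log_le_growth_pow n)
  exact_mod_cast le_of_pow_le_pow_left₀ (by norm_num) (Nat.cast_nonneg _) this

lemma eventually_growth_sq_le : ∀ᶠ n : ℕ in atTop, growth n ^ 2 ≤ n := by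
  have h := (Real.isLittleO_log_id_atTop.comp_tendsto
    (tendsto_natCast_atTop_atTop (R := ℝ))).bound (c := 1 / 162) (by norm_num)
  filter_upwards [h, eventually_ge_atTop 2] with n hn h2
  have hlog : 0 ≤ Real.log n := Real.log_natCast_nonneg n
  simp only [Function.comp_apply, id, Real.norm_eq_abs, abs_of_nonneg hlog, Nat.abs_cast] at hn
  have h4 := growth_pow_le h2
  have h5 : (growth n : ℝ) ^ 4 ≤ n := by linarith
  have h6 : growth n ^ 4 ≤ n := by exact_mod_cast h5
  exact (Nat.pow_le_pow_right (one_le_growth n) (by norm_num)).trans h6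

lemma iterations_isBigO :
    (fun n : ℕ => ((2 * iterations n + 1 : ℕ) : ℝ)) =O[atTop]
      fun n : ℕ => Real.log (n : ℝ) / Real.log (Real.log (n : ℝ)) := by
  have hl := Real.tendsto_log_atTop.comp (tendsto_natCast_atTop_atTop (R := ℝ))
  have hll := Real.tendsto_log_atTop.comp hl
  -- The term `2 * iterations n` costs 8, since `ll ≤ 4 * Real.log (growth n)`; the final round
  -- costs 1, since `ll ≤ l`.
  refine IsBigO.of_bound 9 ?_
  filter_upwards [hl.eventually_ge_atTop 1, hll.eventually_ge_atTop 1, eventually_ge_atTop 2]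
    with n h1 h2 hn
  simp only [Function.comp_apply] at h1 h2
  set l := Real.log (n : ℝ) with hldef
  set ll := Real.log l with hlldef
  have hll_le : ll ≤ l := (Real.log_le_sub_one_of_pos (by linarith)).trans (by linarith)
  have hg : ll ≤ 4 * Real.log (growth n) := by
    have := Real.log_le_log (by linarith) (log_le_growth_pow n)
    rwa [Real.log_pow] at this
  have hK : (iterations n : ℝ) * Real.log (growth n) ≤ l := by
    rw [← Real.log_pow]
    have hgp : 0 < growth n := one_le_growth n
    refine Real.log_le_log (by positivity) ?_
    have : growth n ^ iterations n ≤ n :=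
      (Nat.pow_le_pow_right hgp (Nat.sub_le _ _)).trans (Nat.pow_log_le_self _ (by omega))
    exact_mod_cast this
  have hK0 : (0 : ℝ) ≤ iterations n := Nat.cast_nonneg _
  rw [Real.norm_of_nonneg (Nat.cast_nonneg _), Real.norm_of_nonneg (by positivity), ← mul_div_assoc,
    le_div_iff₀ (by linarith)]
  push_cast
  nlinarith

theorem mainTheorem2 (c : ℕ) :
    ∃ A : CongestAlgorithm, ∀ α : ℕ, ∃ (T : ℕ → ℕ) (ρ : ℕ → ℝ),
      ((fun n => (T n : ℝ)) =O[atTop]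
        fun n : ℕ => Real.log (n : ℝ) / Real.log (Real.log (n : ℝ))) ∧
      (ρ =O[atTop] fun n : ℕ => Real.log (n : ℝ)) ∧
      ∀ (V : Type u) [Fintype V] (N : Network V c), ArboricityAtMost N.graph α →
        A.HaltsWithin N (T (Fintype.card V)) ∧
        IsApproxMDS N.graph (ρ (Fintype.card V))
          (A.outputSet N (T (Fintype.card V))) := by
  classical
  refine ⟨packingAlgorithm, fun α => ⟨fun n => 2 * iterations n + 1,
    -- For the finitely many `n` that fail the conditions, the trivial ratio `n` is enough.
    fun n => if 2 * (α + 1) ≤ growth n ∧ growth n ^ 2 ≤ n then (growth n : ℝ) ^ 4 else n,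
    iterations_isBigO, ?_, ?_⟩⟩
  · refine IsBigO.of_bound 162 ?_
    filter_upwards [tendsto_growth.eventually_ge_atTop (2 * (α + 1)), eventually_growth_sq_le,
      eventually_ge_atTop 2] with n h1 h2 h3
    rw [if_pos ⟨h1, h2⟩, Real.norm_of_nonneg (by positivity),
      Real.norm_of_nonneg (Real.log_natCast_nonneg n)]
    exact growth_pow_le h3
  · intro V _ N hG
    refine ⟨haltsWithin_packingAlgorithm N, ?_, fun D hD => ?_⟩
    · rw [outputSet_packingAlgorithm]
      exact isDominating_selected _
    · dsimp only
      split_ifs with h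
      · rw [outputSet_packingAlgorithm]
        exact_mod_cast card_selected_le hG h.1 h.2 hD
      · rcases isEmpty_or_nonempty V with hV | ⟨⟨v⟩⟩
        · simp [Finset.eq_empty_of_isEmpty]
        · have hD0 : 1 ≤ D.card := by
            rw [Nat.succ_le_iff, Finset.card_pos]
            rcases hD v with h | ⟨w, hw, -⟩
            exacts [⟨v, h⟩, ⟨w, hw⟩]
          exact_mod_cast (Finset.card_le_univ _).trans (Nat.le_mul_of_pos_right _ hD0)
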